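/- Let $M$ be a non-empty smooth $n$-dimensional Riemannian manifold without boundary (Hausdorff, $\sigma$-compact, not necessarily compact or connected), and let $\mu$ be a smooth positive volume on $M$, i.e. in each chart $\mu = w(y)\,dy$ with $w$ smooth and positive (for instance the normalized Riemannian volume form, or a Gaussian measure on $\mathbb R^n$). Let $\nabla$ denote the Riemannian gradient and let $\operatorname{div}$ denote the divergence with respect to $\mu$, given in coordinates by $\operatorname{div}X = w^{-1}\sum_i\partial_i(wX^i)$. Represent $\varrho=\rho\mu\in \mathrm{Vol}(M)$ by its density $\rho$. A point of $T^*\mathrm{Vol}(M)$ is a pair $(\rho,\theta)$ of functions on $M$ with $\rho>0$ of class $C^1$ and $\theta$ of class $C^2$, such that $\rho$, $\theta\rho$ and $|\nabla\theta|^2\rho$ are $\mu$-integrable. Put $$m=\int_M\varrho,\qquad \xi=\frac1m\int_M\theta\varrho,\qquad H(\varrho,\theta)=\frac12\int_M|\nabla\theta|^2\varrho+\frac1{2m}\Big(\int_M\theta\varrho\Big)^2 .$$ A continuous function $G$ is called the functional derivative $\delta F/\delta f$ of a functional $F$ at $f$ if $\frac{d}{d\epsilon}\big|_{\epsilon=0}F(f+\epsilon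 h)=\int_M G\,h\,\mu$ for every admissible compactly supported variation $h$. Fix $r\in\{1,2,\dots,\infty\}$; the admissible variations of $\rho$ are the compactly supported functions of class $C^r$, and those of $\theta$ are the compactly supported functions of class $C^{r+1}$. **Theorem.** At every point $(\rho,\theta)$ of $T^*\mathrm{Vol}(M)$ both functional derivatives of $H$ exist and $$\frac{\delta H}{\delta\theta}=-\operatorname{div}(\rho\nabla\theta)+\xi\rho,\qquad \frac{\delta H}{\delta\rho}=\frac12|\nabla\theta|^2+\xi\theta-\frac{\xi^2}{2}.$$ Consequently, for every non-degenerate interval $J\subseteq\mathbb R$ and every curve $t\mapsto(\rho(t),\theta(t))$, $t\in J$, in $T^*\mathrm{Vol}(M)$, Hamilton's equations $\dot\rho=\delta H/\delta\theta$, $\dot\theta=-\delta H/\delta\rho$ hold on $J$ if and only if, for all $t\in J$ and at every point of $M$, $$\dot\rho=-\operatorname{div}(\rho\nabla\theta)+\xi\rho,\qquad \dot\theta=-\frac12|\nabla\theta|^2-\xi\theta+\frac{\xi^2}{2}.$$ Here $\dot\rho,\dot\theta$ are the pointwise time derivatives (one-sided at endpoints of $J$ belonging to $J$), whose existence is part of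 both conditions. -/

import Mathlib

open Set MeasureTheory Bundle
open scoped Manifold ContDiff

noncomputable section

/-- A smooth positive volume on an `n`-dimensional manifold `M`: a measure on `M` which in every
preferred chart `φ_p` equals `w_p(y) dy` with `w_p` smooth and positive on the range of the chart.
This is the measure of a volume form (orientability is not needed); the Riemannian volume is the
case `w_p = √det g_ij`. -/
structure SmoothVolume (n : ℕ) (M : Type*) [TopologicalSpace M]
    [ChartedSpace (EuclideanSpace ℝ (Fin n)) M] [MeasurableSpace M] where
  /-- the measure `μ` -/
  measure : Measure M
  /-- `density p` is the local density `w_p` in the preferred chart at `p` -/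
  density : M → EuclideanSpace ℝ (Fin n) → ℝ
  contDiffOn_density : ∀ p : M,
    ContDiffOn ℝ ∞ (density p) (chartAt (EuclideanSpace ℝ (Fin n)) p).target
  density_pos : ∀ p : M, ∀ y ∈ (chartAt (EuclideanSpace ℝ (Fin n)) p).target, 0 < density p y
  map_chart : ∀ p : M,
    (measure.restrict (chartAt (EuclideanSpace ℝ (Fin n)) p).source).map
        (chartAt (EuclideanSpace ℝ (Fin n)) p) =
      (volume.restrict (chartAt (EuclideanSpace ℝ (Fin n)) p).target).withDensity
        (fun y => ENNReal.ofReal (density p y))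

section Operators

variable {n : ℕ} {M : Type*} [TopologicalSpace M] [ChartedSpace (EuclideanSpace ℝ (Fin n)) M]

/-- The coordinate expression of a vector field `X` in the preferred chart at `p`: the vector
`dφ_p (X (φ_p⁻¹ y))` of its components at the coordinate point `y`. -/
def coordField (X : ∀ x : M, TangentSpace (𝓡 n) x) (p : M) (y : EuclideanSpace ℝ (Fin n)) :
    EuclideanSpace ℝ (Fin n) :=
  mfderiv (𝓡 n) 𝓘(ℝ, EuclideanSpace ℝ (Fin n)) (extChartAt (𝓡 n) p)
    ((extChartAt (𝓡 n) p).symm y) (X ((extChartAt (𝓡 n) p).symm y))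

/-- The divergence of a vector field `X` with respect to the volume `μ` (so that
`L_X μ = (div X) μ`): in the chart at `p` it is `w⁻¹ ∑ᵢ ∂ᵢ (w Xⁱ)`. -/
def divergence [MeasurableSpace M] (μ : SmoothVolume n M) (X : ∀ x : M, TangentSpace (𝓡 n) x)
    (p : M) : ℝ :=
  (μ.density p (extChartAt (𝓡 n) p p))⁻¹ *
    ∑ i : Fin n, fderiv ℝ (fun y => μ.density p y * coordField X p y i) (extChartAt (𝓡 n) p p)
      (EuclideanSpace.single i 1)

/-- The Riemannian gradient: `⟪∇θ(x), v⟫ = dθ_x(v)` for all `v` in `T_x M`. -/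
def riemGrad [RiemannianBundle (fun x : M => TangentSpace (𝓡 n) x)] (θ : M → ℝ) (x : M) :
    TangentSpace (𝓡 n) x :=
  haveI : FiniteDimensional ℝ (TangentSpace (𝓡 n) x) :=
    inferInstanceAs (FiniteDimensional ℝ (EuclideanSpace ℝ (Fin n)))
  haveI : CompleteSpace (TangentSpace (𝓡 n) x) := FiniteDimensional.complete ℝ _
  (InnerProductSpace.toDual ℝ (TangentSpace (𝓡 n) x)).symm (mfderiv (𝓡 n) 𝓘(ℝ, ℝ) θ x)

end Operators

section Hamiltonian

variable {n : ℕ} {M : Type*} [TopologicalSpace M] [ChartedSpace (EuclideanSpace ℝ (Fin n)) M]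
  [MeasurableSpace M]

/-- The total volume `m = ∫ ϱ` of `ϱ = ρ μ`. -/
def totalVolume (μ : SmoothVolume n M) (ρ : M → ℝ) : ℝ :=
  ∫ x, ρ x ∂μ.measure

/-- `ξ = (∫ θ ϱ) / m`, where `ϱ = ρ μ`. -/
def logRate (μ : SmoothVolume n M) (ρ θ : M → ℝ) : ℝ :=
  (∫ x, θ x * ρ x ∂μ.measure) / totalVolume μ ρ

variable [RiemannianBundle (fun x : M => TangentSpace (𝓡 n) x)]

/-- The Hamiltonian `H(ϱ, θ) = ½ ∫ |∇θ|² ϱ + (1 / 2m) (∫ θ ϱ)²`, where `ϱ = ρ μ`. -/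
def coneHamiltonian (μ : SmoothVolume n M) (ρ θ : M → ℝ) : ℝ :=
  1 / 2 * ∫ x, ‖riemGrad (n := n) θ x‖ ^ 2 * ρ x ∂μ.measure +
    1 / (2 * totalVolume μ ρ) * (∫ x, θ x * ρ x ∂μ.measure) ^ 2

/-- Points of `T*Vol(M)`: a positive density `ρ` (so `ϱ = ρ μ` in `Vol(M)`) of finite total volume
and a potential `θ` for which the integrals that occur in the Hamiltonian are finite. -/
structure IsPhasePoint (μ : SmoothVolume n M) (ρ θ : M → ℝ) : Prop where
  contMDiff_density : ContMDiff (𝓡 n) 𝓘(ℝ, ℝ) 1 ρ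
  contMDiff_potential : ContMDiff (𝓡 n) 𝓘(ℝ, ℝ) 2 θ
  pos : ∀ x, 0 < ρ x
  integrable_density : Integrable ρ μ.measure
  integrable_potential : Integrable (fun x => θ x * ρ x) μ.measure
  integrable_energy : Integrable (fun x => ‖riemGrad (n := n) θ x‖ ^ 2 * ρ x) μ.measure

end Hamiltonian

section HamiltonEquations

variable {n : ℕ} {M : Type*} [TopologicalSpace M] [ChartedSpace (EuclideanSpace ℝ (Fin n)) M]
  [MeasurableSpace M]

/-- The continuous function `G` is the functional derivative `δF/δf` of `F` at `f` for the pairing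
`∫ G h μ`: for every compactly supported variation `h` of class `C^r`,
`d/dε F(f + ε h) = ∫ G h μ` at `ε = 0`. -/
def HasFunctionalDeriv (μ : SmoothVolume n M) (r : ℕ∞) (F : (M → ℝ) → ℝ) (f G : M → ℝ) : Prop :=
  Continuous G ∧
    ∀ h : M → ℝ, ContMDiff (𝓡 n) 𝓘(ℝ, ℝ) r h → HasCompactSupport h →
      HasDerivAt (fun ε : ℝ => F (fun x => f x + ε * h x)) (∫ x, G x * h x ∂μ.measure) 0

/-- Hamilton's equations `ρ̇ = δH/δθ`, `θ̇ = -δH/δρ` on the set `J` of times, for a function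
`H` on `T*Vol(M)`. Variations of `ρ` are of class `C^r` and those of `θ` of class `C^(r+1)`. -/
def SatisfiesHamiltonEquations (μ : SmoothVolume n M) (r : ℕ∞) (H : (M → ℝ) → (M → ℝ) → ℝ)
    (J : Set ℝ) (ρ θ : ℝ → M → ℝ) : Prop :=
  ∀ t ∈ J, ∃ ρ' θ' : M → ℝ,
    (∀ x, HasDerivWithinAt (fun s => ρ s x) (ρ' x) J t) ∧
    (∀ x, HasDerivWithinAt (fun s => θ s x) (θ' x) J t) ∧
    HasFunctionalDeriv μ (r + 1) (fun η => H (ρ t) η) (θ t) ρ' ∧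
    HasFunctionalDeriv μ r (fun σ => H σ (θ t)) (ρ t) (fun x => -θ' x)

end HamiltonEquations

end

/-! Along a line `θ + ε h` the Hamiltonian is a quadratic polynomial in `ε`. Along `ρ + ε h` it is
an affine function plus a squared affine function divided by twice the affine function `m + ε ∫ h
μ`. Both expansions are exact, so the derivatives at `ε = 0` are one-variable calculus, with no
differentiation under the integral sign; `m > 0` keeps the quotient differentiable.

The `θ`-derivative contains `∫ ⟪∇θ, ∇h⟫ ρ μ = ∫ dh(ρ∇θ) μ`, which the divergence theorem
`integral_fieldDeriv_eq_neg_integral_mul_divergence` turns into `-∫ h div(ρ∇θ) μ`. The field `ρ∇θ`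
is `C^1` because in coordinates `∇θ` is the inverse metric applied to `dθ` (`isC1Field_riemGrad`).
The divergence theorem is Euclidean integration by parts in each chart, glued by a partition of
unity. Gluing requires the divergence to be independent of the chart. This follows from integration
by parts itself: on an overlap two chart expressions have the same integrals against all test
functions, and both are continuous.

Finally, continuous functional derivatives are unique (`HasFunctionalDeriv.unique`), so Hamilton's
equations say precisely that the time derivatives equal the computed expressions. -/

/-! ### The volume measure in charts. -/

section VolumeInCharts

variable {n : ℕ} {M : Type*} [TopologicalSpace M] [ChartedSpace (EuclideanSpace ℝ (Fin n)) M]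
  [MeasurableSpace M] [BorelSpace M]

namespace SmoothVolume

lemma aemeasurable_chartAt (μ : SmoothVolume n M) (p : M) :
    AEMeasurable (chartAt (EuclideanSpace ℝ (Fin n)) p)
      (μ.measure.restrict (chartAt (EuclideanSpace ℝ (Fin n)) p).source) :=
  (chartAt (EuclideanSpace ℝ (Fin n)) p).continuousOn.aemeasurable
    (chartAt (EuclideanSpace ℝ (Fin n)) p).open_source.measurableSet

/-- The measure of a set in the domain of a chart, computed in this chart. -/
lemma measure_source_inter_preimage (μ : SmoothVolume n M) (p : M)
    {s : Set (EuclideanSpace ℝ (Fin n))} (hs : MeasurableSet s)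
    (hst : s ⊆ (chartAt (EuclideanSpace ℝ (Fin n)) p).target) :
    μ.measure ((chartAt (EuclideanSpace ℝ (Fin n)) p).source ∩
      chartAt (EuclideanSpace ℝ (Fin n)) p ⁻¹' s) =
      ∫⁻ y in s, ENNReal.ofReal (μ.density p y) := by
  set φ := chartAt (EuclideanSpace ℝ (Fin n)) p
  have h := congrArg (fun ν => ν s) (μ.map_chart p)
  rw [Measure.map_apply_of_aemeasurable (μ.aemeasurable_chartAt p) hs,
    Measure.restrict_apply' φ.open_source.measurableSet, withDensity_apply _ hs,
    Measure.restrict_restrict hs, inter_eq_self_of_subset_left hst, inter_comm] at h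
  exact h

/-- The integral of a function supported in the domain of a chart, computed in this chart. -/
lemma integral_eq_setIntegral_chart (μ : SmoothVolume n M) (p : M) {f : M → ℝ}
    {F : EuclideanSpace ℝ (Fin n) → ℝ}
    (hF : ContinuousOn F (chartAt (EuclideanSpace ℝ (Fin n)) p).target)
    (hf : ∀ x ∈ (chartAt (EuclideanSpace ℝ (Fin n)) p).source,
      f x = F (chartAt (EuclideanSpace ℝ (Fin n)) p x))
    (hf0 : ∀ x ∉ (chartAt (EuclideanSpace ℝ (Fin n)) p).source, f x = 0) :
    ∫ x, f x ∂μ.measure =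
      ∫ y in (chartAt (EuclideanSpace ℝ (Fin n)) p).target, μ.density p y * F y := by
  set φ := chartAt (EuclideanSpace ℝ (Fin n)) p
  have hw : ContinuousOn (μ.density p) φ.target := (μ.contDiffOn_density p).continuousOn
  have htm := φ.open_target.measurableSet
  have hwm : AEMeasurable (μ.density p) (volume.restrict φ.target) := hw.aemeasurable htm
  rw [← setIntegral_eq_integral_of_forall_compl_eq_zero hf0,
    setIntegral_congr_fun φ.open_source.measurableSet hf,
    ← integral_map (μ.aemeasurable_chartAt p), μ.map_chart p,
    integral_withDensity_eq_integral_toReal_smul₀ hwm.ennreal_ofReal (by simp)]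
  · refine setIntegral_congr_fun htm fun y hy => ?_
    simp [ENNReal.toReal_ofReal (μ.density_pos p y hy).le]
  · rw [μ.map_chart p]
    exact (hF.aestronglyMeasurable htm).mono_ac (withDensity_absolutelyContinuous _ _)

/-- The density is bounded on a compact coordinate neighbourhood. This makes continuous compactly
supported functions integrable. -/
lemma isLocallyFiniteMeasure (μ : SmoothVolume n M) : IsLocallyFiniteMeasure μ.measure := by
  refine ⟨fun p => ?_⟩
  set φ := chartAt (EuclideanSpace ℝ (Fin n)) p
  obtain ⟨K, hK, hKt, hKc⟩ := local_compact_nhds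
    (φ.open_target.mem_nhds (mem_chart_target (EuclideanSpace ℝ (Fin n)) p))
  have hpre : φ.source ∩ φ ⁻¹' K ∈ nhds p :=
    Filter.inter_mem (chart_source_mem_nhds _ p)
      ((φ.continuousAt (mem_chart_source _ p)).preimage_mem_nhds hK)
  refine ⟨_, hpre, ?_⟩
  rw [μ.measure_source_inter_preimage p hKc.measurableSet hKt]
  have hw : ContinuousOn (μ.density p) K := (μ.contDiffOn_density p).continuousOn.mono hKt
  exact (hw.integrableOn_compact hKc).lintegral_lt_top

/-- A positive density cannot have zero integral over a nonempty open coordinate set. Used to pass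
from a.e. equality of continuous functions to equality, and for `m > 0`. -/
lemma isOpenPosMeasure (μ : SmoothVolume n M) : μ.measure.IsOpenPosMeasure := by
  refine ⟨fun U hU ⟨p, hp⟩ h0 => ?_⟩
  set φ := chartAt (EuclideanSpace ℝ (Fin n)) p
  have hV : IsOpen (φ.target ∩ φ.symm ⁻¹' U) := φ.isOpen_inter_preimage_symm hU
  have hne : (φ.target ∩ φ.symm ⁻¹' U).Nonempty :=
    ⟨φ p, mem_chart_target _ p, by
      simpa [φ.left_inv (mem_chart_source _ p)] using hp⟩
  have h1 := μ.measure_source_inter_preimage p hV.measurableSet inter_subset_left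
  have h2 : μ.measure (φ.source ∩ φ ⁻¹' (φ.target ∩ φ.symm ⁻¹' U)) = 0 := by
    refine measure_mono_null (fun x hx => ?_) h0
    have := hx.2.2
    rwa [mem_preimage, φ.left_inv hx.1] at this
  have hw : AEMeasurable (fun y => ENNReal.ofReal (μ.density p y))
      (volume.restrict (φ.target ∩ φ.symm ⁻¹' U)) :=
    (((μ.contDiffOn_density p).continuousOn.mono inter_subset_left).aemeasurable
      hV.measurableSet).ennreal_ofReal
  rw [h2, eq_comm, lintegral_eq_zero_iff' hw, Filter.EventuallyEq,
    ae_restrict_iff' hV.measurableSet] at h1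
  refine hV.measure_ne_zero volume hne (measure_mono_null (fun y hy => ?_) h1)
  simpa using ⟨hy.1, hy.2, μ.density_pos p y hy.1⟩

end SmoothVolume

end VolumeInCharts

/-! ### Integration by parts in Euclidean space. -/

section IntegrationByPartsInCoordinates

/-- Integration by parts against a compactly supported function, for a vector field which is
of class `C^1` near the support of this function. -/
lemma integral_fderiv_apply_eq_neg_integral_mul_sum {n : ℕ}
    {T : Set (EuclideanSpace ℝ (Fin n))} (hT : IsOpen T)
    {F : EuclideanSpace ℝ (Fin n) → EuclideanSpace ℝ (Fin n)} (hF : ContDiffOn ℝ 1 F T)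
    {g : EuclideanSpace ℝ (Fin n) → ℝ} (hg : ContDiff ℝ 1 g) (hgc : HasCompactSupport g)
    (hgT : tsupport g ⊆ T) :
    ∫ y, fderiv ℝ g y (F y) =
      -∫ y, g y * ∑ i, fderiv ℝ (fun z => F z i) y (EuclideanSpace.single i 1) := by
  have hFi : ∀ i, ContDiffOn ℝ 1 (fun z => F z i) T := fun i =>
    (contDiffOn_piLp 2).1 hF i
  have hFc : ∀ i, ContinuousOn (fun z => F z i) T := fun i => (hFi i).continuousOn
  have hF' : ∀ i, ContinuousOn (fun y => fderiv ℝ (fun z => F z i) y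
      (EuclideanSpace.single i (1 : ℝ))) T := fun i =>
    ((hFi i).continuousOn_fderiv_of_isOpen hT le_rfl).clm_apply continuousOn_const
  have hg' : Continuous (fderiv ℝ g) := hg.continuous_fderiv one_ne_zero
  -- Outside `T` nothing is known about `u`, but the product vanishes off the compact support of
  -- `g`, which lies in `T`, so it is globally continuous.
  have key : ∀ {u v : EuclideanSpace ℝ (Fin n) → ℝ}, ContinuousOn u T → Continuous v →
      tsupport v ⊆ tsupport g → Integrable (fun y => u y * v y) := by
    intro u v hu hv hvg
    have hvc : HasCompactSupport v := hgc.mono' ((subset_tsupport v).trans hvg)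
    refine Continuous.integrable_of_hasCompactSupport ?_ hvc.mul_left
    refine ContinuousOn.continuous_of_tsupport_subset (hu.mul hv.continuousOn) hT ?_
    exact (tsupport_mul_subset_right).trans (hvg.trans hgT)
  have hsub : ∀ i, tsupport (fun y => fderiv ℝ g y (EuclideanSpace.single i (1 : ℝ))) ⊆
      tsupport g := fun i => tsupport_fderiv_apply_subset ℝ _
  have h1 : ∀ i, Integrable (fun y => F y i * fderiv ℝ g y (EuclideanSpace.single i 1)) :=
    fun i => key (hFc i) (hg'.clm_apply continuous_const) (hsub i)
  have h2 : ∀ i, Integrable (fun y => fderiv ℝ (fun z => F z i) y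
      (EuclideanSpace.single i 1) * g y) :=
    fun i => key (hF' i) hg.continuous le_rfl
  have hexp : ∀ y, fderiv ℝ g y (F y) =
      ∑ i, F y i * fderiv ℝ g y (EuclideanSpace.single i 1) := by
    intro y
    have : F y = ∑ i, F y i • EuclideanSpace.single i (1 : ℝ) := by
      ext j
      simp [Finset.sum_apply, Pi.single_apply]
    conv_lhs => rw [this]
    simp
  simp_rw [hexp, Finset.mul_sum]
  rw [integral_finsetSum _ fun i _ => h1 i,
    integral_finsetSum _ fun i _ => by simpa only [mul_comm] using h2 i,
    ← Finset.sum_neg_distrib]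
  refine Finset.sum_congr rfl fun i _ => ?_
  rw [integral_mul_fderiv_eq_neg_fderiv_mul_of_integrable (h2 i) (h1 i)
    (key (hFc i) hg.continuous le_rfl)
    (fun x hx => ((hFi i).differentiableOn one_ne_zero).differentiableAt (hT.mem_nhds (hgT hx)))
    (fun x _ => (hg.differentiable one_ne_zero) x)]
  simp only [mul_comm]

end IntegrationByPartsInCoordinates

/-! ### Functions and fields read in a chart. -/

section FunctionsInCharts

variable {n : ℕ} {M : Type*} [TopologicalSpace M] [ChartedSpace (EuclideanSpace ℝ (Fin n)) M]
  [IsManifold (𝓡 n) ∞ M]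

lemma ContMDiff.contDiffOn_comp_chartAt_symm {k : WithTop ℕ∞} (hk : k ≤ ∞) {h : M → ℝ}
    (hh : ContMDiff (𝓡 n) 𝓘(ℝ, ℝ) k h) (p : M) :
    ContDiffOn ℝ k (h ∘ (chartAt (EuclideanSpace ℝ (Fin n)) p).symm)
      (chartAt (EuclideanSpace ℝ (Fin n)) p).target := by
  have : IsManifold (𝓡 n) k M := .of_le hk
  exact contMDiffOn_iff_contDiffOn.1 (hh.comp_contMDiffOn contMDiffOn_chart_symm)

omit [IsManifold (𝓡 n) ∞ M] in
lemma coordField_chartAt (X : ∀ x : M, TangentSpace (𝓡 n) x) (p : M) {x : M}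
    (hx : x ∈ (chartAt (EuclideanSpace ℝ (Fin n)) p).source) :
    coordField X p (chartAt (EuclideanSpace ℝ (Fin n)) p x) =
      mfderiv (𝓡 n) 𝓘(ℝ, EuclideanSpace ℝ (Fin n)) (extChartAt (𝓡 n) p) x (X x) := by
  have h : (extChartAt (𝓡 n) p).symm (chartAt (EuclideanSpace ℝ (Fin n)) p x) = x := by
    simpa using (chartAt (EuclideanSpace ℝ (Fin n)) p).left_inv hx
  -- The type of `X a` depends on `a`, so the base point is replaced everywhere at once.
  exact congrArg (fun a => (mfderiv (𝓡 n) 𝓘(ℝ, EuclideanSpace ℝ (Fin n)) (extChartAt (𝓡 n) p) a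
    (X a) : EuclideanSpace ℝ (Fin n))) h

lemma mfderiv_eq_fderiv_comp_chartAt_symm {h : M → ℝ} (hh : ContMDiff (𝓡 n) 𝓘(ℝ, ℝ) 1 h) (p : M)
    {x : M} (hx : x ∈ (chartAt (EuclideanSpace ℝ (Fin n)) p).source)
    (v : TangentSpace (𝓡 n) x) :
    mfderiv (𝓡 n) 𝓘(ℝ, ℝ) h x v =
      fderiv ℝ (h ∘ (chartAt (EuclideanSpace ℝ (Fin n)) p).symm)
        (chartAt (EuclideanSpace ℝ (Fin n)) p x)
        (mfderiv (𝓡 n) 𝓘(ℝ, EuclideanSpace ℝ (Fin n)) (extChartAt (𝓡 n) p) x v) := by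
  set φ := chartAt (EuclideanSpace ℝ (Fin n)) p
  have : IsManifold (𝓡 n) 1 M := .of_le (n := ∞) (by norm_cast)
  have hd := ((hh.contDiffOn_comp_chartAt_symm (by exact_mod_cast le_top) p).differentiableOn
    one_ne_zero).differentiableAt (φ.open_target.mem_nhds (φ.map_source hx))
  have heq : h =ᶠ[nhds x] (h ∘ φ.symm) ∘ extChartAt (𝓡 n) p := by
    filter_upwards [φ.open_source.mem_nhds hx] with z hz
    simp [φ, φ.left_inv hz]
  have hc : MDifferentiableAt (𝓡 n) 𝓘(ℝ, EuclideanSpace ℝ (Fin n)) (extChartAt (𝓡 n) p) x :=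
    mdifferentiableAt_extChartAt hx
  have hφ : extChartAt (𝓡 n) p x = φ x := by simp [φ]
  rw [heq.mfderiv_eq, mfderiv_comp x (by rw [hφ]; exact hd.mdifferentiableAt) hc,
    mfderiv_eq_fderiv]
  rfl

/-- The expression in the chart at `p` of a function on `M`, extended by zero. -/
noncomputable def chartExtend (h : M → ℝ) (p : M) : EuclideanSpace ℝ (Fin n) → ℝ :=
  (chartAt (EuclideanSpace ℝ (Fin n)) p).target.indicator
    (h ∘ (chartAt (EuclideanSpace ℝ (Fin n)) p).symm)

-- The image of the compact support is compact, hence closed in the whole coordinate space; the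
-- extension by zero therefore stays away from the boundary of the chart target.
omit [IsManifold (𝓡 n) ∞ M] in
lemma tsupport_chartExtend_subset {h : M → ℝ} {p : M} (hc : HasCompactSupport h)
    (hs : tsupport h ⊆ (chartAt (EuclideanSpace ℝ (Fin n)) p).source) :
    tsupport (chartExtend (n := n) h p) ⊆ chartAt (EuclideanSpace ℝ (Fin n)) p '' tsupport h := by
  set φ := chartAt (EuclideanSpace ℝ (Fin n)) p
  have hK : IsCompact (φ '' tsupport h) := hc.isCompact.image_of_continuousOn
    (φ.continuousOn.mono hs)
  refine closure_minimal (fun y hy => ?_) hK.isClosed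
  obtain ⟨hy1, hy2⟩ := (Set.support_indicator (f := h ∘ φ.symm) ▸ hy : y ∈ φ.target ∩ _)
  exact ⟨φ.symm y, subset_tsupport h hy2, φ.right_inv hy1⟩

omit [IsManifold (𝓡 n) ∞ M] in
lemma hasCompactSupport_chartExtend {h : M → ℝ} {p : M} (hc : HasCompactSupport h)
    (hs : tsupport h ⊆ (chartAt (EuclideanSpace ℝ (Fin n)) p).source) :
    HasCompactSupport (chartExtend (n := n) h p) :=
  HasCompactSupport.of_support_subset_isCompact (hc.isCompact.image_of_continuousOn
    ((chartAt (EuclideanSpace ℝ (Fin n)) p).continuousOn.mono hs))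
    ((subset_tsupport _).trans (tsupport_chartExtend_subset hc hs))

omit [IsManifold (𝓡 n) ∞ M] in
lemma tsupport_chartExtend_subset_target {h : M → ℝ} {p : M} (hc : HasCompactSupport h)
    (hs : tsupport h ⊆ (chartAt (EuclideanSpace ℝ (Fin n)) p).source) :
    tsupport (chartExtend (n := n) h p) ⊆ (chartAt (EuclideanSpace ℝ (Fin n)) p).target := by
  refine (tsupport_chartExtend_subset hc hs).trans ?_
  rintro _ ⟨x, hx, rfl⟩
  exact OpenPartialHomeomorph.map_source _ (hs hx)

omit [IsManifold (𝓡 n) ∞ M] in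
lemma chartExtend_eventuallyEq (h : M → ℝ) (p : M) {y : EuclideanSpace ℝ (Fin n)}
    (hy : y ∈ (chartAt (EuclideanSpace ℝ (Fin n)) p).target) :
    chartExtend h p =ᶠ[nhds y] h ∘ (chartAt (EuclideanSpace ℝ (Fin n)) p).symm := by
  filter_upwards [(chartAt (EuclideanSpace ℝ (Fin n)) p).open_target.mem_nhds hy] with z hz
  exact indicator_of_mem hz _

lemma contDiff_chartExtend {h : M → ℝ} {p : M} (hh : ContMDiff (𝓡 n) 𝓘(ℝ, ℝ) 1 h)
    (hc : HasCompactSupport h)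
    (hs : tsupport h ⊆ (chartAt (EuclideanSpace ℝ (Fin n)) p).source) :
    ContDiff ℝ 1 (chartExtend (n := n) h p) := by
  refine contDiff_iff_contDiffAt.2 fun y => ?_
  by_cases hy : y ∈ tsupport (chartExtend (n := n) h p)
  · have hyt := tsupport_chartExtend_subset_target hc hs hy
    exact (((hh.contDiffOn_comp_chartAt_symm (by exact_mod_cast le_top) p).contDiffAt
      ((chartAt (EuclideanSpace ℝ (Fin n)) p).open_target.mem_nhds hyt))).congr_of_eventuallyEq
      (chartExtend_eventuallyEq h p hyt)
  · exact contDiffAt_const.congr_of_eventuallyEq (notMem_tsupport_iff_eventuallyEq.1 hy)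

end FunctionsInCharts

/-! ### Derivatives of functions along vector fields. -/

section FieldDerivative

variable {n : ℕ} {M : Type*} [TopologicalSpace M] [ChartedSpace (EuclideanSpace ℝ (Fin n)) M]

/-- The derivative `dh(X)` of a function `h` along a vector field `X`. -/
noncomputable def fieldDeriv (X : ∀ x : M, TangentSpace (𝓡 n) x) (h : M → ℝ) (x : M) : ℝ :=
  mfderiv (𝓡 n) 𝓘(ℝ, ℝ) h x (X x)

lemma fieldDeriv_zero (X : ∀ x : M, TangentSpace (𝓡 n) x) (x : M) : fieldDeriv X 0 x = 0 := by
  change mfderiv (𝓡 n) 𝓘(ℝ, ℝ) (fun _ => (0 : ℝ)) x (X x) = (0 : ℝ)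
  rw [mfderiv_const]
  rfl

lemma fieldDeriv_add (X : ∀ x : M, TangentSpace (𝓡 n) x) {f g : M → ℝ} {x : M}
    (hf : MDifferentiableAt (𝓡 n) 𝓘(ℝ, ℝ) f x) (hg : MDifferentiableAt (𝓡 n) 𝓘(ℝ, ℝ) g x) :
    fieldDeriv X (f + g) x = fieldDeriv X f x + fieldDeriv X g x := by
  unfold fieldDeriv
  rw [mfderiv_add hf hg]
  rfl

lemma fieldDeriv_of_notMem_tsupport (X : ∀ x : M, TangentSpace (𝓡 n) x) {h : M → ℝ} {x : M}
    (hx : x ∉ tsupport h) : fieldDeriv X h x = 0 := by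
  rw [← fieldDeriv_zero X x]
  unfold fieldDeriv
  rw [(notMem_tsupport_iff_eventuallyEq.1 hx).mfderiv_eq]
  rfl

lemma HasCompactSupport.fieldDeriv {h : M → ℝ} (hc : HasCompactSupport h)
    (X : ∀ x : M, TangentSpace (𝓡 n) x) : HasCompactSupport (fieldDeriv X h) :=
  hc.mono' fun x hx => by
    by_contra hx'
    exact hx (fieldDeriv_of_notMem_tsupport X hx')

lemma fieldDeriv_eq_fderiv_comp_chartAt_symm [IsManifold (𝓡 n) ∞ M]
    (X : ∀ x : M, TangentSpace (𝓡 n) x) {h : M → ℝ} (hh : ContMDiff (𝓡 n) 𝓘(ℝ, ℝ) 1 h) (p : M)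
    {x : M} (hx : x ∈ (chartAt (EuclideanSpace ℝ (Fin n)) p).source) :
    fieldDeriv X h x =
      fderiv ℝ (h ∘ (chartAt (EuclideanSpace ℝ (Fin n)) p).symm)
        (chartAt (EuclideanSpace ℝ (Fin n)) p x)
        (coordField X p (chartAt (EuclideanSpace ℝ (Fin n)) p x)) := by
  rw [coordField_chartAt X p hx]
  exact mfderiv_eq_fderiv_comp_chartAt_symm hh p hx (X x)

end FieldDerivative

/-! ### Divergence and the divergence theorem. -/

section LocalDivergence

variable {n : ℕ} {M : Type*} [TopologicalSpace M] [ChartedSpace (EuclideanSpace ℝ (Fin n)) M]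
  [MeasurableSpace M]

/-- The divergence of a vector field, computed in the chart at `p`, as a function of the
coordinates. -/
noncomputable def chartDivergence (μ : SmoothVolume n M) (X : ∀ x : M, TangentSpace (𝓡 n) x)
    (p : M) (y : EuclideanSpace ℝ (Fin n)) : ℝ :=
  (μ.density p y)⁻¹ *
    ∑ i : Fin n, fderiv ℝ (fun z => μ.density p z * coordField X p z i) y
      (EuclideanSpace.single i 1)

lemma divergence_eq_chartDivergence (μ : SmoothVolume n M)
    (X : ∀ x : M, TangentSpace (𝓡 n) x) (p : M) :
    divergence μ X p = chartDivergence μ X p (chartAt (EuclideanSpace ℝ (Fin n)) p p) := by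
  simp [divergence, chartDivergence]

/-- A vector field is of class `C^1` if its components in all preferred charts are. -/
def IsC1Field (X : ∀ x : M, TangentSpace (𝓡 n) x) : Prop :=
  ∀ p : M, ContDiffOn ℝ 1 (coordField X p) (chartAt (EuclideanSpace ℝ (Fin n)) p).target

lemma contDiffOn_density_smul_coordField (μ : SmoothVolume n M)
    {X : ∀ x : M, TangentSpace (𝓡 n) x} (hX : IsC1Field X) (p : M) :
    ContDiffOn ℝ 1 (fun y => μ.density p y • coordField X p y)
      (chartAt (EuclideanSpace ℝ (Fin n)) p).target :=
  ((μ.contDiffOn_density p).of_le (by norm_cast)).smul (hX p)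

lemma continuousOn_chartDivergence (μ : SmoothVolume n M)
    {X : ∀ x : M, TangentSpace (𝓡 n) x} (hX : IsC1Field X) (p : M) :
    ContinuousOn (chartDivergence μ X p) (chartAt (EuclideanSpace ℝ (Fin n)) p).target := by
  refine ((μ.contDiffOn_density p).continuousOn.inv₀
    fun y hy => (μ.density_pos p y hy).ne').mul ?_
  refine continuousOn_finsetSum _ fun i _ => ?_
  have h := (contDiffOn_piLp 2).1 (contDiffOn_density_smul_coordField μ hX p) i
  exact (h.continuousOn_fderiv_of_isOpen (OpenPartialHomeomorph.open_target _) le_rfl).clm_apply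
    continuousOn_const

variable [IsManifold (𝓡 n) ∞ M]

omit [MeasurableSpace M] in
lemma continuous_fieldDeriv {X : ∀ x : M, TangentSpace (𝓡 n) x} (hX : IsC1Field X) {h : M → ℝ}
    (hh : ContMDiff (𝓡 n) 𝓘(ℝ, ℝ) 1 h) :
    Continuous fun x => fieldDeriv X h x := by
  refine continuous_iff_continuousAt.2 fun p => ?_
  set φ := chartAt (EuclideanSpace ℝ (Fin n)) p
  have h1 := (hh.contDiffOn_comp_chartAt_symm (by exact_mod_cast le_top)
    p).continuousOn_fderiv_of_isOpen φ.open_target le_rfl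
  have h2 : ContinuousOn (fun x => fderiv ℝ (h ∘ φ.symm) (φ x) (coordField X p (φ x)))
      φ.source := (h1.clm_apply (hX p).continuousOn).comp φ.continuousOn φ.mapsTo
  refine (h2.congr fun x hx => ?_).continuousAt (chart_source_mem_nhds _ p)
  exact fieldDeriv_eq_fderiv_comp_chartAt_symm X hh p hx

variable [BorelSpace M]

lemma integrable_fieldDeriv (μ : SmoothVolume n M) {X : ∀ x : M, TangentSpace (𝓡 n) x}
    (hX : IsC1Field X) {h : M → ℝ} (hh : ContMDiff (𝓡 n) 𝓘(ℝ, ℝ) 1 h)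
    (hc : HasCompactSupport h) :
    Integrable (fun x => fieldDeriv X h x) μ.measure := by
  have := μ.isLocallyFiniteMeasure
  exact (continuous_fieldDeriv hX hh).integrable_of_hasCompactSupport (hc.fieldDeriv X)

/-- Integration by parts in the domain of a chart. -/
lemma integral_fieldDeriv_eq_of_tsupport_subset (μ : SmoothVolume n M)
    {X : ∀ x : M, TangentSpace (𝓡 n) x} (hX : IsC1Field X) (p : M) {h : M → ℝ}
    (hh : ContMDiff (𝓡 n) 𝓘(ℝ, ℝ) 1 h) (hc : HasCompactSupport h)
    (hs : tsupport h ⊆ (chartAt (EuclideanSpace ℝ (Fin n)) p).source) :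
    ∫ x, fieldDeriv X h x ∂μ.measure =
      -∫ x, h x * chartDivergence μ X p (chartAt (EuclideanSpace ℝ (Fin n)) p x) ∂μ.measure := by
  set φ := chartAt (EuclideanSpace ℝ (Fin n)) p
  have hg := contDiff_chartExtend hh hc hs
  have hgT := tsupport_chartExtend_subset_target hc hs
  have hg0 : ∀ x ∉ φ.source, h x = 0 := fun x hx =>
    image_eq_zero_of_notMem_tsupport fun h' => hx (hs h')
  have hdg0 : ∀ y ∉ φ.target, fderiv ℝ (chartExtend h p) y = 0 := fun y hy =>
    image_eq_zero_of_notMem_tsupport fun h' => hy (hgT (tsupport_fderiv_subset ℝ h'))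
  have h0 : ∀ y ∉ φ.target, chartExtend h p y = 0 := fun y hy => indicator_of_notMem hy _
  rw [μ.integral_eq_setIntegral_chart p
      (F := fun y => fderiv ℝ (chartExtend h p) y (coordField X p y))
      ((hg.continuous_fderiv one_ne_zero).continuousOn.clm_apply (hX p).continuousOn),
    μ.integral_eq_setIntegral_chart p
      (F := fun y => chartExtend h p y * chartDivergence μ X p y)
      (hg.continuous.continuousOn.mul (continuousOn_chartDivergence μ hX p))]
  -- The Euclidean formula is applied to `w X`; the weight `w` of the measure then cancels the `w⁻¹`
  -- in the divergence.
  · have key := integral_fderiv_apply_eq_neg_integral_mul_sum φ.open_target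
      (contDiffOn_density_smul_coordField μ hX p) hg (hasCompactSupport_chartExtend hc hs) hgT
    rw [← setIntegral_eq_integral_of_forall_compl_eq_zero (s := φ.target)
        (f := fun y => fderiv ℝ (chartExtend h p) y (μ.density p y • coordField X p y))
        (fun y hy => by simp only [hdg0 y hy, zero_apply]),
      ← setIntegral_eq_integral_of_forall_compl_eq_zero (s := φ.target)
        (f := fun y => chartExtend h p y * _)
        (fun y hy => by simp only [h0 y hy, zero_mul])] at key
    refine Eq.trans ?_ (key.trans ?_)
    · refine setIntegral_congr_fun φ.open_target.measurableSet fun y _ => ?_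
      simp
    · refine congrArg Neg.neg (setIntegral_congr_fun φ.open_target.measurableSet fun y hy => ?_)
      have hw := (μ.density_pos p y hy).ne'
      simp only [chartDivergence, PiLp.smul_apply, smul_eq_mul]
      field_simp
  · intro x hx
    rw [chartExtend, indicator_of_mem (φ.map_source hx), Function.comp_apply, φ.left_inv hx]
  · intro x hx
    rw [hg0 x hx, zero_mul]
  · intro x hx
    rw [fieldDeriv_eq_fderiv_comp_chartAt_symm X hh p hx,
      (chartExtend_eventuallyEq h p (φ.map_source hx)).fderiv_eq]
  · intro x hx
    exact fieldDeriv_of_notMem_tsupport X fun h' => hx (hs h')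

variable [T2Space M] [SigmaCompactSpace M]

/-- The divergence does not depend on the chart used to compute it. -/
lemma divergence_eq_chartDivergence_of_mem (μ : SmoothVolume n M)
    {X : ∀ x : M, TangentSpace (𝓡 n) x} (hX : IsC1Field X) (p : M) {q : M}
    (hq : q ∈ (chartAt (EuclideanSpace ℝ (Fin n)) p).source) :
    divergence μ X q = chartDivergence μ X p (chartAt (EuclideanSpace ℝ (Fin n)) p q) := by
  have := μ.isLocallyFiniteMeasure
  have := μ.isOpenPosMeasure
  have : SecondCountableTopology M :=
    ChartedSpace.secondCountable_of_sigmaCompact (EuclideanSpace ℝ (Fin n)) M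
  have hcont : ∀ a : M, ContinuousOn
      (fun x => chartDivergence μ X a (chartAt (EuclideanSpace ℝ (Fin n)) a x))
      (chartAt (EuclideanSpace ℝ (Fin n)) a).source := fun a =>
    (continuousOn_chartDivergence μ hX a).comp (OpenPartialHomeomorph.continuousOn _)
      (OpenPartialHomeomorph.mapsTo _)
  set U := (chartAt (EuclideanSpace ℝ (Fin n)) p).source ∩
    (chartAt (EuclideanSpace ℝ (Fin n)) q).source
  have hU : IsOpen U := (OpenPartialHomeomorph.open_source _).inter
    (OpenPartialHomeomorph.open_source _)
  have hp := (hcont p).mono (inter_subset_left : U ⊆ _)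
  have hq' := (hcont q).mono (inter_subset_right : U ⊆ _)
  -- For a test function `g` supported in the overlap, both chart expressions integrate against `g`
  -- to `-∫ dg(X) μ`, so their difference is zero a.e. No transformation law for densities is
  -- needed.
  have key := hU.ae_eq_zero_of_integral_contMDiff_smul_eq_zero (𝓡 n) (μ := μ.measure)
    ((hq'.sub hp).locallyIntegrableOn hU.measurableSet) fun g hg hgc hgU => by
      have hg1 : ContMDiff (𝓡 n) 𝓘(ℝ, ℝ) 1 g := hg.of_le (by norm_cast)
      have hi : ∀ {f : M → ℝ}, ContinuousOn f U → Integrable (fun x => g x * f x) μ.measure :=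
        fun hf => Continuous.integrable_of_hasCompactSupport
          (ContinuousOn.continuous_of_tsupport_subset (hg.continuous.continuousOn.mul hf) hU
            (tsupport_mul_subset_left.trans hgU)) hgc.mul_right
      simp only [Pi.sub_apply, smul_eq_mul, mul_sub]
      rw [integral_sub (hi hq') (hi hp), sub_eq_zero]
      refine neg_injective ?_
      rw [← integral_fieldDeriv_eq_of_tsupport_subset μ hX p hg1 hgc
          (hgU.trans inter_subset_left),
        ← integral_fieldDeriv_eq_of_tsupport_subset μ hX q hg1 hgc
          (hgU.trans inter_subset_right)]
  have h2 := Measure.eqOn_open_of_ae_eq (g := fun _ => (0 : ℝ))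
    ((ae_restrict_iff' hU.measurableSet).2 key) hU (hq'.sub hp) continuousOn_const
  have h3 := h2 ⟨hq, mem_chart_source _ q⟩
  rw [divergence_eq_chartDivergence]
  exact sub_eq_zero.1 h3

/-- By definition the chart used at `q` varies with `q`, possibly discontinuously; chart
independence allows one fixed chart near each point. -/
lemma continuous_divergence (μ : SmoothVolume n M)
    {X : ∀ x : M, TangentSpace (𝓡 n) x} (hX : IsC1Field X) : Continuous (divergence μ X) := by
  refine continuous_iff_continuousAt.2 fun p => ?_
  refine ContinuousOn.continuousAt (s := (chartAt (EuclideanSpace ℝ (Fin n)) p).source) ?_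
    (chart_source_mem_nhds _ p)
  exact ((continuousOn_chartDivergence μ hX p).comp (OpenPartialHomeomorph.continuousOn _)
    (OpenPartialHomeomorph.mapsTo _)).congr
    fun q hq => divergence_eq_chartDivergence_of_mem μ hX p hq

/-- The divergence theorem: `-div X` is the adjoint of the differential. -/
theorem integral_fieldDeriv_eq_neg_integral_mul_divergence (μ : SmoothVolume n M)
    {X : ∀ x : M, TangentSpace (𝓡 n) x} (hX : IsC1Field X) {h : M → ℝ}
    (hh : ContMDiff (𝓡 n) 𝓘(ℝ, ℝ) 1 h) (hc : HasCompactSupport h) :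
    ∫ x, fieldDeriv X h x ∂μ.measure =
      -∫ x, h x * divergence μ X x ∂μ.measure := by
  classical
  have := μ.isLocallyFiniteMeasure
  obtain ⟨f, hf⟩ := SmoothPartitionOfUnity.exists_isSubordinate_chartAt_source (𝓡 n) M
  -- Only finitely many members of the partition meet the support of `h`, so `h` is a finite sum of
  -- functions each supported in one chart.
  have hfin := f.locallyFinite.finite_nonempty_inter_compact hc.isCompact
  have hf1 : ∀ i, ContMDiff (𝓡 n) 𝓘(ℝ, ℝ) 1 (f i) := fun i =>
    (f i).contMDiff.of_le (by norm_cast)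
  have hsum : h = ∑ i ∈ hfin.toFinset, fun x => f i x * h x := by
    ext x
    rw [Finset.sum_apply, ← Finset.sum_mul]
    by_cases hx : h x = 0
    · simp [hx]
    · rw [f.sum_finsupport' x (mem_univ x), one_mul]
      intro i hi
      rw [Finite.mem_toFinset]
      exact ⟨x, (f.mem_finsupport x).1 hi, subset_tsupport h hx⟩
  -- Regularity and compact support are carried through the induction because additivity of the
  -- derivative and of the integrals requires them.
  have hloc : ∀ s : Finset M,
      ContMDiff (𝓡 n) 𝓘(ℝ, ℝ) 1 (∑ i ∈ s, fun x => f i x * h x) ∧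
      HasCompactSupport (∑ i ∈ s, fun x => f i x * h x) ∧
      ∫ x, fieldDeriv X (∑ i ∈ s, fun x => f i x * h x) x ∂μ.measure =
        -∫ x, (∑ i ∈ s, fun x => f i x * h x) x * divergence μ X x ∂μ.measure := by
    intro s
    induction s using Finset.induction_on with
    | empty =>
      refine ⟨contMDiff_const, HasCompactSupport.zero, ?_⟩
      simp [fieldDeriv_zero]
    | insert i s hi ih =>
      obtain ⟨ih1, ih2, ih3⟩ := ih
      have h1 : ContMDiff (𝓡 n) 𝓘(ℝ, ℝ) 1 (fun x => f i x * h x) := (hf1 i).mul hh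
      have h2 : HasCompactSupport (fun x => f i x * h x) := hc.mul_left
      have h3 : tsupport (fun x => f i x * h x) ⊆
          (chartAt (EuclideanSpace ℝ (Fin n)) i).source :=
        tsupport_mul_subset_left.trans (hf i)
      have h4 : ∫ x, fieldDeriv X (fun x => f i x * h x) x ∂μ.measure =
          -∫ x, (f i x * h x) * divergence μ X x ∂μ.measure := by
        rw [integral_fieldDeriv_eq_of_tsupport_subset μ hX i h1 h2 h3]
        refine congrArg Neg.neg (integral_congr_ae (ae_of_all _ fun x => ?_))
        by_cases hx : x ∈ (chartAt (EuclideanSpace ℝ (Fin n)) i).source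
        · simp only [divergence_eq_chartDivergence_of_mem μ hX i hx]
        · have : f i x * h x = 0 := image_eq_zero_of_notMem_tsupport
            (f := fun x => f i x * h x) fun h' => hx (h3 h')
          simp [this]
      have hdiv := continuous_divergence μ hX
      rw [Finset.sum_insert hi]
      refine ⟨h1.add ih1, h2.add ih2, ?_⟩
      have hadd := fun x => fieldDeriv_add X (h1.mdifferentiable one_ne_zero x)
        (ih1.mdifferentiable one_ne_zero x)
      simp_rw [hadd, Pi.add_apply, add_mul]
      rw [integral_add (integrable_fieldDeriv μ hX h1 h2)
          (integrable_fieldDeriv μ hX ih1 ih2), h4, ih3,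
        ← neg_add, ← integral_add
          (f := fun x => f i x * h x * divergence μ X x)
          (g := fun x => (∑ i ∈ s, fun x => f i x * h x) x * divergence μ X x)
          ((h1.continuous.mul hdiv).integrable_of_hasCompactSupport h2.mul_right)
          ((ih1.continuous.mul hdiv).integrable_of_hasCompactSupport ih2.mul_right)]
  have := (hloc hfin.toFinset).2.2
  rwa [← hsum] at this

end LocalDivergence

/-! ### The Riemannian gradient in coordinates. -/

section GradientInCharts

variable {n : ℕ} {M : Type*} [TopologicalSpace M] [ChartedSpace (EuclideanSpace ℝ (Fin n)) M]
  [IsManifold (𝓡 n) ∞ M]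

section Frame

/-- The coordinate vector field in the chart at `p` with constant components `v`. -/
noncomputable def coordVectorField (p : M) (v : EuclideanSpace ℝ (Fin n)) (x : M) :
    TangentSpace (𝓡 n) x :=
  haveI : IsManifold (𝓡 n) 1 M := .of_le (n := ∞) (by norm_cast)
  (trivializationAt (EuclideanSpace ℝ (Fin n)) (TangentSpace (𝓡 n)) p).symmL ℝ x v

lemma coordVectorField_add (p : M) (u v : EuclideanSpace ℝ (Fin n)) (x : M) :
    coordVectorField p (u + v) x = coordVectorField p u x + coordVectorField p v x :=
  map_add _ _ _

lemma coordVectorField_smul (p : M) (a : ℝ) (v : EuclideanSpace ℝ (Fin n)) (x : M) :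
    coordVectorField p (a • v) x = a • coordVectorField p v x :=
  map_smul _ _ _

lemma mfderiv_extChartAt_coordVectorField {p x : M}
    (hx : x ∈ (chartAt (EuclideanSpace ℝ (Fin n)) p).source) (v : EuclideanSpace ℝ (Fin n)) :
    mfderiv (𝓡 n) 𝓘(ℝ, EuclideanSpace ℝ (Fin n)) (extChartAt (𝓡 n) p) x
      (coordVectorField p v x) = v := by
  have : IsManifold (𝓡 n) 1 M := .of_le (n := ∞) (by norm_cast)
  rw [← TangentBundle.continuousLinearMapAt_trivializationAt hx]
  exact Trivialization.continuousLinearMapAt_symmL _ (by simpa using hx) v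

lemma coordVectorField_mfderiv_extChartAt {p x : M}
    (hx : x ∈ (chartAt (EuclideanSpace ℝ (Fin n)) p).source) (X : TangentSpace (𝓡 n) x) :
    coordVectorField p (mfderiv (𝓡 n) 𝓘(ℝ, EuclideanSpace ℝ (Fin n)) (extChartAt (𝓡 n) p) x X) x
      = X := by
  have : IsManifold (𝓡 n) 1 M := .of_le (n := ∞) (by norm_cast)
  rw [← TangentBundle.continuousLinearMapAt_trivializationAt hx]
  exact Trivialization.symmL_continuousLinearMapAt _ (by simpa using hx) X

/-- In the trivialization at `p` this section is the constant `v`. -/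
lemma contMDiffOn_coordVectorField (p : M) (v : EuclideanSpace ℝ (Fin n)) :
    ContMDiffOn (𝓡 n) ((𝓡 n).prod 𝓘(ℝ, EuclideanSpace ℝ (Fin n))) ∞
      (fun x => (⟨x, coordVectorField p v x⟩ :
        TotalSpace (EuclideanSpace ℝ (Fin n)) (TangentSpace (𝓡 n) : M → Type _)))
      (chartAt (EuclideanSpace ℝ (Fin n)) p).source := by
  have : IsManifold (𝓡 n) 1 M := .of_le (n := ∞) (by norm_cast)
  have h := ((trivializationAt (EuclideanSpace ℝ (Fin n))
    (TangentSpace (𝓡 n) : M → Type _) p).contMDiffOn_section_baseSet_iff (n := ∞) (IB := 𝓡 n)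
    (s := coordVectorField p v)).2
  rw [TangentBundle.trivializationAt_baseSet] at h
  refine h ((contMDiffOn_const (c := v)).congr fun x hx => ?_)
  have hb : x ∈ (trivializationAt (EuclideanSpace ℝ (Fin n))
      (TangentSpace (𝓡 n) : M → Type _) p).baseSet := by
    rwa [TangentBundle.trivializationAt_baseSet]
  exact (Trivialization.continuousLinearMapAt_apply_of_mem (R := ℝ) _ hb _).symm.trans
    (Trivialization.continuousLinearMapAt_symmL (R := ℝ) _ hb v)

end Frame

variable [RiemannianBundle (fun x : M => TangentSpace (𝓡 n) x)]

omit [IsManifold (𝓡 n) ∞ M] in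
lemma inner_riemGrad (θ : M → ℝ) (x : M) (v : TangentSpace (𝓡 n) x) :
    inner ℝ (riemGrad θ x) v = (mfderiv (𝓡 n) 𝓘(ℝ, ℝ) θ x v : ℝ) := by
  have : FiniteDimensional ℝ (TangentSpace (𝓡 n) x) :=
    inferInstanceAs (FiniteDimensional ℝ (EuclideanSpace ℝ (Fin n)))
  have : CompleteSpace (TangentSpace (𝓡 n) x) := FiniteDimensional.complete ℝ _
  exact InnerProductSpace.toDual_symm_apply

/-- The Riemannian metric in the chart at `p`, as a bilinear form on the coordinate space. -/
noncomputable def coordMetric (p x : M) :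
    EuclideanSpace ℝ (Fin n) →L[ℝ] EuclideanSpace ℝ (Fin n) →L[ℝ] ℝ :=
  LinearMap.toContinuousBilinearMap <|
    LinearMap.mk₂ ℝ (fun u v => inner ℝ (coordVectorField p u x) (coordVectorField p v x))
      (fun _ _ _ => by rw [coordVectorField_add, inner_add_left])
      (fun _ _ _ => by rw [coordVectorField_smul, real_inner_smul_left]; rfl)
      (fun _ _ _ => by rw [coordVectorField_add, inner_add_right])
      (fun _ _ _ => by rw [coordVectorField_smul, real_inner_smul_right]; rfl)

lemma coordMetric_apply (p x : M) (u v : EuclideanSpace ℝ (Fin n)) :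
    coordMetric p x u v = inner ℝ (coordVectorField p u x) (coordVectorField p v x) :=
  rfl

/-- Positive definiteness gives injectivity, and the coordinate space and its dual have equal
dimension. -/
lemma exists_coordMetric_eq_equiv {p x : M}
    (hx : x ∈ (chartAt (EuclideanSpace ℝ (Fin n)) p).source) :
    ∃ e : EuclideanSpace ℝ (Fin n) ≃L[ℝ] (EuclideanSpace ℝ (Fin n) →L[ℝ] ℝ),
      (e : EuclideanSpace ℝ (Fin n) →L[ℝ] (EuclideanSpace ℝ (Fin n) →L[ℝ] ℝ)) =
        coordMetric p x := by
  have hinj : Function.Injective (coordMetric (n := n) p x).toLinearMap := by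
    refine (injective_iff_map_eq_zero _).2 fun u hu => ?_
    have h0 : coordMetric p x u u = 0 := by
      change (coordMetric p x).toLinearMap u u = 0
      rw [hu]
      rfl
    rw [coordMetric_apply, inner_self_eq_zero] at h0
    rw [← mfderiv_extChartAt_coordVectorField hx u, h0]
    exact map_zero _
  have hdim : Module.finrank ℝ (EuclideanSpace ℝ (Fin n)) =
      Module.finrank ℝ (EuclideanSpace ℝ (Fin n) →L[ℝ] ℝ) :=
    (InnerProductSpace.toDual ℝ (EuclideanSpace ℝ (Fin n))).toLinearEquiv.finrank_eq
  refine ⟨(LinearEquiv.ofInjectiveOfFinrankEq _ hinj hdim).toContinuousLinearEquiv, ?_⟩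
  ext u v
  rfl

/-- This is `(∇θ)ⁱ = gⁱʲ ∂ⱼθ`, written without indices so that smoothness of operator inversion
applies. -/
lemma coordField_riemGrad {θ : M → ℝ} (hθ : ContMDiff (𝓡 n) 𝓘(ℝ, ℝ) 1 θ) (p : M)
    {y : EuclideanSpace ℝ (Fin n)} (hy : y ∈ (chartAt (EuclideanSpace ℝ (Fin n)) p).target) :
    coordField (riemGrad θ) p y =
      (coordMetric p ((chartAt (EuclideanSpace ℝ (Fin n)) p).symm y)).inverse
        (fderiv ℝ (θ ∘ (chartAt (EuclideanSpace ℝ (Fin n)) p).symm) y) := by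
  set φ := chartAt (EuclideanSpace ℝ (Fin n)) p
  have hx : φ.symm y ∈ φ.source := φ.map_target hy
  obtain ⟨e, he⟩ := exists_coordMetric_eq_equiv hx
  rw [← he, ContinuousLinearMap.inverse_equiv]
  refine ((e.symm_apply_eq).2 ?_).symm
  change _ = (e : EuclideanSpace ℝ (Fin n) →L[ℝ] (EuclideanSpace ℝ (Fin n) →L[ℝ] ℝ)) _
  rw [he]
  ext v
  have hc : coordField (riemGrad θ) p y = _ := (congrArg _ (φ.right_inv hy).symm).trans
    (coordField_chartAt (riemGrad θ) p hx)
  have hV : coordVectorField p (coordField (riemGrad θ) p y) (φ.symm y) =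
      riemGrad θ (φ.symm y) := by
    rw [hc]
    exact coordVectorField_mfderiv_extChartAt hx _
  rw [coordMetric_apply, hV, inner_riemGrad]
  refine Eq.symm ((mfderiv_eq_fderiv_comp_chartAt_symm hθ p hx _).trans ?_)
  refine (congrArg _ (mfderiv_extChartAt_coordVectorField hx v)).trans ?_
  rw [φ.right_inv hy]

variable [IsContMDiffRiemannianBundle (𝓡 n) ∞ (EuclideanSpace ℝ (Fin n))
  (fun x : M => TangentSpace (𝓡 n) x)]

lemma contDiffOn_coordMetric (p : M) :
    ContDiffOn ℝ 1 (fun y => coordMetric (n := n) p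
      ((chartAt (EuclideanSpace ℝ (Fin n)) p).symm y))
      (chartAt (EuclideanSpace ℝ (Fin n)) p).target := by
  refine contDiffOn_clm_apply.2 fun u => contDiffOn_clm_apply.2 fun v => ?_
  have h : ContMDiffOn (𝓡 n) 𝓘(ℝ, ℝ) ∞
      (fun x => inner ℝ (coordVectorField p u x) (coordVectorField p v x))
      (chartAt (EuclideanSpace ℝ (Fin n)) p).source :=
    (contMDiffOn_coordVectorField p u).inner_bundle (contMDiffOn_coordVectorField p v)
  have h2 := h.comp (contMDiffOn_chart_symm (I := 𝓡 n) (x := p) (n := ∞))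
    (OpenPartialHomeomorph.mapsTo_symm _)
  exact (contMDiffOn_iff_contDiffOn.1 h2).of_le (by norm_cast)

/-- Inversion is smooth at invertible operators, the metric coefficients are smooth, and `dθ` is
`C^1`. -/
lemma isC1Field_riemGrad {θ : M → ℝ} (hθ : ContMDiff (𝓡 n) 𝓘(ℝ, ℝ) 2 θ) :
    IsC1Field (riemGrad (n := n) θ) := by
  intro p
  have hopen := (chartAt (EuclideanSpace ℝ (Fin n)) p).open_target
  refine ContDiffOn.congr (fun y hy => ?_)
    fun y hy => coordField_riemGrad (hθ.of_le (by norm_num)) p hy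
  have h1 : ContDiffOn ℝ 1 (fderiv ℝ (θ ∘ (chartAt (EuclideanSpace ℝ (Fin n)) p).symm))
      (chartAt (EuclideanSpace ℝ (Fin n)) p).target :=
    (hθ.contDiffOn_comp_chartAt_symm ENat.LEInfty.out p).fderiv_of_isOpen hopen
      (by norm_num)
  obtain ⟨e, he⟩ := exists_coordMetric_eq_equiv (OpenPartialHomeomorph.map_target _ hy)
  have h2 : ContDiffAt ℝ 1 ContinuousLinearMap.inverse
      (coordMetric (n := n) p ((chartAt (EuclideanSpace ℝ (Fin n)) p).symm y)) :=
    he ▸ contDiffAt_map_inverse e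
  exact (h2.comp_contDiffWithinAt y (contDiffOn_coordMetric p y hy)).clm_apply (h1 y hy)

omit [RiemannianBundle (fun x : M => TangentSpace (𝓡 n) x)]
  [IsContMDiffRiemannianBundle (𝓡 n) ∞ (EuclideanSpace ℝ (Fin n))
    (fun x : M => TangentSpace (𝓡 n) x)] in
lemma IsC1Field.smul {X : ∀ x : M, TangentSpace (𝓡 n) x} (hX : IsC1Field X) {ρ : M → ℝ}
    (hρ : ContMDiff (𝓡 n) 𝓘(ℝ, ℝ) 1 ρ) : IsC1Field (fun x => ρ x • X x) := by
  intro p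
  refine ((hρ.contDiffOn_comp_chartAt_symm (by exact_mod_cast le_top) p).smul (hX p)).congr
    fun y _ => ?_
  exact map_smul (mfderiv (𝓡 n) 𝓘(ℝ, EuclideanSpace ℝ (Fin n)) (extChartAt (𝓡 n) p) _) _ _

end GradientInCharts

/-! ### Uniqueness of functional derivatives. -/

section Uniqueness

variable {n : ℕ} {M : Type*} [TopologicalSpace M] [ChartedSpace (EuclideanSpace ℝ (Fin n)) M]
  [IsManifold (𝓡 n) ∞ M] [MeasurableSpace M] [BorelSpace M] [T2Space M] [SigmaCompactSpace M]

/-- The functional derivative is unique. -/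
lemma HasFunctionalDeriv.unique {μ : SmoothVolume n M} {r : ℕ∞} {F : (M → ℝ) → ℝ}
    {f G G' : M → ℝ} (hG : HasFunctionalDeriv μ r F f G) (hG' : HasFunctionalDeriv μ r F f G') :
    G = G' := by
  have := μ.isLocallyFiniteMeasure
  have := μ.isOpenPosMeasure
  have : SecondCountableTopology M :=
    ChartedSpace.secondCountable_of_sigmaCompact (EuclideanSpace ℝ (Fin n)) M
  refine Continuous.ae_eq_iff_eq μ.measure hG.1 hG'.1 |>.1 ?_
  refine ae_eq_of_integral_contMDiff_smul_eq (𝓡 n) hG.1.locallyIntegrable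
    hG'.1.locallyIntegrable fun h hh hc => ?_
  -- Smooth test functions are admissible for every `r` and already separate continuous functions.
  have hr : ContMDiff (𝓡 n) 𝓘(ℝ, ℝ) r h := hh.of_le (by exact_mod_cast le_top)
  simpa only [smul_eq_mul, mul_comm] using (hG.2 h hr hc).unique (hG'.2 h hr hc)

end Uniqueness

/-! ### The two functional derivatives of the Hamiltonian. -/

section FunctionalDerivatives

variable {n : ℕ} {M : Type*} [TopologicalSpace M] [ChartedSpace (EuclideanSpace ℝ (Fin n)) M]
  [RiemannianBundle (fun x : M => TangentSpace (𝓡 n) x)]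

lemma norm_riemGrad_sq (θ : M → ℝ) (x : M) :
    ‖riemGrad (n := n) θ x‖ ^ 2 = fieldDeriv (n := n) (riemGrad θ) θ x :=
  (real_inner_self_eq_norm_sq _).symm.trans (inner_riemGrad θ x _)

/-- Puts the cross term of the energy in the form to which the divergence theorem applies. -/
lemma fieldDeriv_smul_riemGrad (ρ θ h : M → ℝ) (x : M) :
    fieldDeriv (n := n) (fun y => ρ y • riemGrad θ y) h x =
      inner ℝ (riemGrad (n := n) θ x) (riemGrad h x) * ρ x := by
  have h1 : fieldDeriv (n := n) (fun y => ρ y • riemGrad θ y) h x =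
      ρ x * inner ℝ (riemGrad h x) (riemGrad (n := n) θ x) := by
    rw [inner_riemGrad]
    exact map_smul (mfderiv (𝓡 n) 𝓘(ℝ, ℝ) h x) _ _
  rw [h1, real_inner_comm, mul_comm]

lemma riemGrad_add_mul {θ h : M → ℝ} {x : M} (hθ : MDifferentiableAt (𝓡 n) 𝓘(ℝ, ℝ) θ x)
    (hh : MDifferentiableAt (𝓡 n) 𝓘(ℝ, ℝ) h x) (ε : ℝ) :
    riemGrad (n := n) (fun y => θ y + ε * h y) x = riemGrad θ x + ε • riemGrad h x := by
  refine ext_inner_right ℝ fun v => ?_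
  rw [inner_add_left, real_inner_smul_left, inner_riemGrad, inner_riemGrad, inner_riemGrad]
  have h1 : mfderiv (𝓡 n) 𝓘(ℝ, ℝ) (θ + ε • h) x = _ := mfderiv_add hθ (hh.const_smul ε)
  have h2 : mfderiv (𝓡 n) 𝓘(ℝ, ℝ) (ε • h) x = _ := const_smul_mfderiv hh ε
  rw [h2] at h1
  exact congrArg (fun L => L v) h1

lemma norm_riemGrad_add_mul_sq {θ h : M → ℝ} {x : M}
    (hθ : MDifferentiableAt (𝓡 n) 𝓘(ℝ, ℝ) θ x)
    (hh : MDifferentiableAt (𝓡 n) 𝓘(ℝ, ℝ) h x) (ε : ℝ) :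
    ‖riemGrad (n := n) (fun y => θ y + ε * h y) x‖ ^ 2 =
      ‖riemGrad (n := n) θ x‖ ^ 2 + 2 * ε * inner ℝ (riemGrad (n := n) θ x) (riemGrad h x) +
        ε ^ 2 * ‖riemGrad (n := n) h x‖ ^ 2 := by
  rw [riemGrad_add_mul hθ hh, norm_add_sq_real, real_inner_smul_right, norm_smul, mul_pow,
    Real.norm_eq_abs, sq_abs]
  ring

variable [MeasurableSpace M] [BorelSpace M]

lemma IsPhasePoint.totalVolume_pos [Nonempty M] {μ : SmoothVolume n M} {ρ θ : M → ℝ}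
    (h : IsPhasePoint μ ρ θ) : 0 < totalVolume μ ρ := by
  have := μ.isOpenPosMeasure
  rw [totalVolume, integral_pos_iff_support_of_nonneg (fun x => (h.pos x).le)
    h.integrable_density]
  have : Function.support ρ = univ := eq_univ_of_forall fun x => (h.pos x).ne'
  rw [this]
  exact isOpen_univ.measure_pos _ univ_nonempty

variable [IsManifold (𝓡 n) ∞ M]
  [IsContMDiffRiemannianBundle (𝓡 n) ∞ (EuclideanSpace ℝ (Fin n))
    (fun x : M => TangentSpace (𝓡 n) x)]

omit [MeasurableSpace M] [BorelSpace M] in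
lemma continuous_norm_riemGrad_sq {θ : M → ℝ} (hθ : ContMDiff (𝓡 n) 𝓘(ℝ, ℝ) 2 θ) :
    Continuous fun x => ‖riemGrad (n := n) θ x‖ ^ 2 := by
  simp_rw [norm_riemGrad_sq (n := n)]
  exact continuous_fieldDeriv (isC1Field_riemGrad hθ) (hθ.of_le (by norm_num))

/-- The functional derivative of the Hamiltonian with respect to the potential. -/
lemma IsPhasePoint.hasFunctionalDeriv_potential [T2Space M] [SigmaCompactSpace M]
    {μ : SmoothVolume n M} {ρ θ : M → ℝ}
    (hp : IsPhasePoint μ ρ θ) {r : ℕ∞} (hr : 2 ≤ r) :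
    HasFunctionalDeriv μ r (fun η => coneHamiltonian μ ρ η) θ
      (fun x => -divergence μ (fun y => ρ y • riemGrad θ y) x + logRate μ ρ θ * ρ x) := by
  have := μ.isLocallyFiniteMeasure
  have hX : IsC1Field (fun y => ρ y • riemGrad (n := n) θ y) :=
    (isC1Field_riemGrad hp.contMDiff_potential).smul hp.contMDiff_density
  have hdiv := continuous_divergence μ hX
  have hρ := hp.contMDiff_density.continuous
  refine ⟨hdiv.neg.add (continuous_const.mul hρ), fun h hh hc => ?_⟩
  have hh2 : ContMDiff (𝓡 n) 𝓘(ℝ, ℝ) 2 h := hh.of_le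
    (WithTop.coe_le_coe.2 hr)
  have hh1 : ContMDiff (𝓡 n) 𝓘(ℝ, ℝ) 1 h := hh2.of_le (by norm_num)
  have hθd := hp.contMDiff_potential.mdifferentiable two_ne_zero
  have hhd := hh2.mdifferentiable two_ne_zero
  have hcE : HasCompactSupport fun x => ‖riemGrad (n := n) h x‖ ^ 2 := by
    simp_rw [norm_riemGrad_sq (n := n)]
    exact hc.fieldDeriv _
  have i1 : Integrable (fun x => inner ℝ (riemGrad (n := n) θ x) (riemGrad h x) * ρ x)
      μ.measure := by
    simp_rw [← fieldDeriv_smul_riemGrad (n := n)]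
    exact integrable_fieldDeriv μ hX hh1 hc
  have i2 : Integrable (fun x => ‖riemGrad (n := n) h x‖ ^ 2 * ρ x) μ.measure :=
    ((continuous_norm_riemGrad_sq hh2).mul hρ).integrable_of_hasCompactSupport hcE.mul_right
  have i3 : Integrable (fun x => h x * ρ x) μ.measure :=
    (hh.continuous.mul hρ).integrable_of_hasCompactSupport hc.mul_right
  have i4 : Integrable (fun x => h x * divergence μ (fun y => ρ y • riemGrad θ y) x) μ.measure :=
    (hh.continuous.mul hdiv).integrable_of_hasCompactSupport hc.mul_right
  -- Each coefficient is a finite integral: the terms without `h` by the phase point conditions, the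
  -- others by compact support.
  have hH : ∀ ε : ℝ, coneHamiltonian μ ρ (fun x => θ x + ε * h x) =
      1 / 2 * (∫ x, ‖riemGrad (n := n) θ x‖ ^ 2 * ρ x ∂μ.measure +
          ε * (2 * ∫ x, inner ℝ (riemGrad (n := n) θ x) (riemGrad h x) * ρ x ∂μ.measure) +
          ε ^ 2 * ∫ x, ‖riemGrad (n := n) h x‖ ^ 2 * ρ x ∂μ.measure) +
        1 / (2 * totalVolume μ ρ) *
          (∫ x, θ x * ρ x ∂μ.measure + ε * ∫ x, h x * ρ x ∂μ.measure) ^ 2 := by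
    intro ε
    have e1 : ∫ x, ‖riemGrad (n := n) (fun y => θ y + ε * h y) x‖ ^ 2 * ρ x ∂μ.measure =
        ∫ x, ‖riemGrad (n := n) θ x‖ ^ 2 * ρ x ∂μ.measure +
          ε * (2 * ∫ x, inner ℝ (riemGrad (n := n) θ x) (riemGrad h x) * ρ x ∂μ.measure) +
          ε ^ 2 * ∫ x, ‖riemGrad (n := n) h x‖ ^ 2 * ρ x ∂μ.measure := by
      rw [← integral_const_mul, ← integral_const_mul, ← integral_const_mul,
        ← integral_add hp.integrable_energy ((i1.const_mul 2).const_mul ε),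
        ← integral_add (f := fun x => ‖riemGrad (n := n) θ x‖ ^ 2 * ρ x + _)
          (hp.integrable_energy.add ((i1.const_mul 2).const_mul ε)) (i2.const_mul _)]
      refine integral_congr_ae (ae_of_all _ fun x => ?_)
      simp only
      rw [norm_riemGrad_add_mul_sq (hθd x) (hhd x)]
      ring
    have e2 : ∫ x, (θ x + ε * h x) * ρ x ∂μ.measure =
        ∫ x, θ x * ρ x ∂μ.measure + ε * ∫ x, h x * ρ x ∂μ.measure := by
      rw [← integral_const_mul, ← integral_add hp.integrable_potential (i3.const_mul ε)]
      simp only [add_mul, mul_assoc]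
    rw [coneHamiltonian, e1, e2]
  have hG : ∫ x, (-divergence μ (fun y => ρ y • riemGrad θ y) x + logRate μ ρ θ * ρ x) * h x
      ∂μ.measure =
      ∫ x, inner ℝ (riemGrad (n := n) θ x) (riemGrad h x) * ρ x ∂μ.measure +
        logRate μ ρ θ * ∫ x, h x * ρ x ∂μ.measure := by
    simp_rw [← fieldDeriv_smul_riemGrad (n := n)]
    rw [integral_fieldDeriv_eq_neg_integral_mul_divergence μ hX hh1 hc, ← integral_neg,
      ← integral_const_mul, ← integral_add (f := fun x => -(h x * _)) i4.neg (i3.const_mul _)]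
    refine integral_congr_ae (ae_of_all _ fun x => ?_)
    simp only
    ring
  simp_rw [hH]
  rw [hG, logRate]
  generalize totalVolume μ ρ = m at *
  generalize ∫ x, ‖riemGrad (n := n) θ x‖ ^ 2 * ρ x ∂μ.measure = A
  generalize ∫ x, inner ℝ (riemGrad (n := n) θ x) (riemGrad h x) * ρ x ∂μ.measure = B
  generalize ∫ x, ‖riemGrad (n := n) h x‖ ^ 2 * ρ x ∂μ.measure = C
  generalize ∫ x, θ x * ρ x ∂μ.measure = a
  generalize ∫ x, h x * ρ x ∂μ.measure = b
  have hlin : ∀ u v : ℝ, HasDerivAt (fun ε : ℝ => u + ε * v) v 0 := fun u v => by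
    simpa using ((hasDerivAt_id (0 : ℝ)).mul_const v).const_add u
  have hsq : HasDerivAt (fun ε : ℝ => ε ^ 2 * C) 0 0 := by
    simpa using (hasDerivAt_pow 2 (0 : ℝ)).mul_const C
  refine ((((hlin A (2 * B)).add hsq).const_mul (1 / 2)).add
    (((hlin a b).pow 2).const_mul (1 / (2 * m)))).congr_deriv ?_
  -- If `M` is empty then `m = 0`; the convention `1 / 0 = 0` keeps the identity true, so it is
  -- proved without `m ≠ 0`.
  simp
  field_simp

/-- The functional derivative of the Hamiltonian with respect to the density. -/
lemma IsPhasePoint.hasFunctionalDeriv_density [Nonempty M] {μ : SmoothVolume n M} {ρ θ : M → ℝ}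
    (hp : IsPhasePoint μ ρ θ) (r : ℕ∞) :
    HasFunctionalDeriv μ r (fun σ => coneHamiltonian μ σ θ) ρ
      (fun x => 1 / 2 * ‖riemGrad (n := n) θ x‖ ^ 2 + logRate μ ρ θ * θ x
        - logRate μ ρ θ ^ 2 / 2) := by
  have := μ.isLocallyFiniteMeasure
  have hE := continuous_norm_riemGrad_sq hp.contMDiff_potential
  have hθ := hp.contMDiff_potential.continuous
  refine ⟨((continuous_const.mul hE).add (continuous_const.mul hθ)).sub continuous_const,
    fun h hh hc => ?_⟩
  have hcont := hh.continuous
  have hm := hp.totalVolume_pos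
  have i1 : Integrable (fun x => ‖riemGrad (n := n) θ x‖ ^ 2 * h x) μ.measure :=
    (hE.mul hcont).integrable_of_hasCompactSupport hc.mul_left
  have i2 : Integrable (fun x => θ x * h x) μ.measure :=
    (hθ.mul hcont).integrable_of_hasCompactSupport hc.mul_left
  have i3 : Integrable h μ.measure := hcont.integrable_of_hasCompactSupport hc
  -- Positivity of `ρ + ε h` plays no role: the expansion holds for every `ε`, with `0⁻¹ = 0` if the
  -- perturbed volume vanishes.
  have hH : ∀ ε : ℝ, coneHamiltonian μ (fun x => ρ x + ε * h x) θ =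
      1 / 2 * (∫ x, ‖riemGrad (n := n) θ x‖ ^ 2 * ρ x ∂μ.measure +
          ε * ∫ x, ‖riemGrad (n := n) θ x‖ ^ 2 * h x ∂μ.measure) +
        (2 * (totalVolume μ ρ + ε * ∫ x, h x ∂μ.measure))⁻¹ *
          (∫ x, θ x * ρ x ∂μ.measure + ε * ∫ x, θ x * h x ∂μ.measure) ^ 2 := by
    intro ε
    have e1 : ∫ x, ‖riemGrad (n := n) θ x‖ ^ 2 * (ρ x + ε * h x) ∂μ.measure =
        ∫ x, ‖riemGrad (n := n) θ x‖ ^ 2 * ρ x ∂μ.measure +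
          ε * ∫ x, ‖riemGrad (n := n) θ x‖ ^ 2 * h x ∂μ.measure := by
      rw [← integral_const_mul, ← integral_add hp.integrable_energy (i1.const_mul ε)]
      simp only [mul_add, mul_left_comm]
    have e2 : ∫ x, θ x * (ρ x + ε * h x) ∂μ.measure =
        ∫ x, θ x * ρ x ∂μ.measure + ε * ∫ x, θ x * h x ∂μ.measure := by
      rw [← integral_const_mul, ← integral_add hp.integrable_potential (i2.const_mul ε)]
      simp only [mul_add, mul_left_comm]
    have e3 : totalVolume μ (fun x => ρ x + ε * h x) =
        totalVolume μ ρ + ε * ∫ x, h x ∂μ.measure := by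
      rw [totalVolume, integral_add hp.integrable_density (i3.const_mul ε), integral_const_mul,
        totalVolume]
    rw [coneHamiltonian, e1, e2, e3, one_div (2 * _)]
  have hG : ∫ x, (1 / 2 * ‖riemGrad (n := n) θ x‖ ^ 2 + logRate μ ρ θ * θ x
      - logRate μ ρ θ ^ 2 / 2) * h x ∂μ.measure =
      1 / 2 * ∫ x, ‖riemGrad (n := n) θ x‖ ^ 2 * h x ∂μ.measure +
        logRate μ ρ θ * ∫ x, θ x * h x ∂μ.measure -
        logRate μ ρ θ ^ 2 / 2 * ∫ x, h x ∂μ.measure := by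
    rw [← integral_const_mul, ← integral_const_mul, ← integral_const_mul,
      ← integral_add (i1.const_mul _) (i2.const_mul _),
      ← integral_sub (f := fun x => 1 / 2 * (‖riemGrad (n := n) θ x‖ ^ 2 * h x) + _)
        ((i1.const_mul _).add (i2.const_mul _)) (i3.const_mul _)]
    refine integral_congr_ae (ae_of_all _ fun x => ?_)
    simp only
    ring
  simp_rw [hH]
  rw [hG, logRate]
  generalize totalVolume μ ρ = m at *
  generalize ∫ x, ‖riemGrad (n := n) θ x‖ ^ 2 * ρ x ∂μ.measure = A
  generalize ∫ x, ‖riemGrad (n := n) θ x‖ ^ 2 * h x ∂μ.measure = B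
  generalize ∫ x, θ x * ρ x ∂μ.measure = a
  generalize ∫ x, θ x * h x ∂μ.measure = b
  generalize ∫ x, h x ∂μ.measure = d
  have hlin : ∀ u v : ℝ, HasDerivAt (fun ε : ℝ => u + ε * v) v 0 := fun u v => by
    simpa using ((hasDerivAt_id (0 : ℝ)).mul_const v).const_add u
  -- The quotient is differentiated only at `ε = 0`, where its denominator is `2m > 0`. The
  -- derivative of `1 / (2m)` yields the term `-ξ² / 2`.
  have hne : 2 * (m + 0 * d) ≠ 0 := by simpa using hm.ne'
  refine (((hlin A B).const_mul (1 / 2)).add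
    ((((hlin m d).const_mul 2).inv hne).mul ((hlin a b).pow 2))).congr_deriv ?_
  simp
  field_simp
  ring

end FunctionalDerivatives

/-! ### Hamilton's equations. -/

theorem mainTheorem4 {n : ℕ} {M : Type*} [TopologicalSpace M] [T2Space M] [SigmaCompactSpace M]
    [Nonempty M] [ChartedSpace (EuclideanSpace ℝ (Fin n)) M] [IsManifold (𝓡 n) ∞ M]
    [RiemannianBundle (fun x : M => TangentSpace (𝓡 n) x)]
    [IsContMDiffRiemannianBundle (𝓡 n) ∞ (EuclideanSpace ℝ (Fin n))
      (fun x : M => TangentSpace (𝓡 n) x)]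
    [MeasurableSpace M] [BorelSpace M] (μ : SmoothVolume n M) (r : ℕ∞) (hr : 1 ≤ r) :
    (∀ ρ θ : M → ℝ, IsPhasePoint μ ρ θ →
      HasFunctionalDeriv μ (r + 1) (fun η => coneHamiltonian μ ρ η) θ
        (fun x => -divergence μ (fun y => ρ y • riemGrad θ y) x + logRate μ ρ θ * ρ x) ∧
      HasFunctionalDeriv μ r (fun σ => coneHamiltonian μ σ θ) ρ
        (fun x => 1 / 2 * ‖riemGrad (n := n) θ x‖ ^ 2 + logRate μ ρ θ * θ x
          - logRate μ ρ θ ^ 2 / 2)) ∧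
    (∀ (J : Set ℝ) (ρ θ : ℝ → M → ℝ), J.OrdConnected → J.Nontrivial →
      (∀ t ∈ J, IsPhasePoint μ (ρ t) (θ t)) →
      (SatisfiesHamiltonEquations μ r (coneHamiltonian μ) J ρ θ ↔
        ∀ t ∈ J, ∀ x : M,
          HasDerivWithinAt (fun s => ρ s x)
            (-divergence μ (fun y => ρ t y • riemGrad (θ t) y) x
              + logRate μ (ρ t) (θ t) * ρ t x) J t ∧
          HasDerivWithinAt (fun s => θ s x)
            (-(1 / 2) * ‖riemGrad (n := n) (θ t) x‖ ^ 2 - logRate μ (ρ t) (θ t) * θ t x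
              + logRate μ (ρ t) (θ t) ^ 2 / 2) J t))  := by
  -- Variations of `θ` have class `r + 1 ≥ 2`, which makes `∇h` a `C^1` field.
  have key : ∀ ρ θ : M → ℝ, IsPhasePoint μ ρ θ → _ ∧ _ := fun ρ θ hp =>
    And.intro (hp.hasFunctionalDeriv_potential (r := r + 1)
      (by simpa [one_add_one_eq_two] using add_le_add_left hr 1)) (hp.hasFunctionalDeriv_density r)
  refine ⟨key, fun J ρ θ _ _ hp => ⟨fun hH t ht x => ?_, fun hH t ht => ?_⟩⟩
  · obtain ⟨ρ', θ', hρ', hθ', hdρ, hdθ⟩ := hH t ht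
    obtain ⟨h1, h2⟩ := key _ _ (hp t ht)
    refine ⟨congrFun (hdρ.unique h1) x ▸ hρ' x, ?_⟩
    refine (hθ' x).congr_deriv ?_
    linarith [congrFun (hdθ.unique h2) x]
  · obtain ⟨h1, h2⟩ := key _ _ (hp t ht)
    refine ⟨_, _, fun x => (hH t ht x).1, fun x => (hH t ht x).2, h1, ?_⟩
    convert h2 using 2 with x
    ring
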